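/- For an integer $k \ge 2$, a set $\mathcal{A} \subseteq \mathbb{N}_0 = \{0,1,2,\dots\}$ and $n \in \mathbb{N}_0$, let $$r^{\le}_k(\mathcal{A},n) = \#\{(a_1,\dots,a_k)\in\mathcal{A}^k : a_1\le\dots\le a_k,\ a_1+\dots+a_k=n\},$$ $$r^{<}_k(\mathcal{A},n) = \#\{(a_1,\dots,a_k)\in\mathcal{A}^k : a_1<\dots<a_k,\ a_1+\dots+a_k=n\}.$$ Let $k \ge 2$ and $\star\in\{\le,<\}$. There does not exist any infinite set $\mathcal{A}\subseteq\mathbb{N}_0$ such that $r^{\star}_k(\mathcal{A},n)$ becomes constant for $n$ large enough. -/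

import Mathlib

/-- The representation function `r^≤_k(A, n)`: the number of tuples `(a_1, …, a_k) ∈ A^k` with
`a_1 ≤ ⋯ ≤ a_k` and `a_1 + ⋯ + a_k = n`. -/
noncomputable def orderedRepLE (k : ℕ) (A : Set ℕ) (n : ℕ) : ℕ :=
  Set.ncard {a : Fin k → ℕ | (∀ i, a i ∈ A) ∧ Monotone a ∧ ∑ i, a i = n}

/-- The representation function `r^<_k(A, n)`: the number of tuples `(a_1, …, a_k) ∈ A^k` with
`a_1 < ⋯ < a_k` and `a_1 + ⋯ + a_k = n`. -/
noncomputable def orderedRepLT (k : ℕ) (A : Set ℕ) (n : ℕ) : ℕ :=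
  Set.ncard {a : Fin k → ℕ | (∀ i, a i ∈ A) ∧ StrictMono a ∧ ∑ i, a i = n}

/-- Only finitely many tuples of natural numbers have a given sum, so the sets counted above are
finite and `Set.ncard` is their true cardinality. -/
theorem finite_tuples_sum_eq (k n : ℕ) : {a : Fin k → ℕ | ∑ i, a i = n}.Finite := by
  refine (Set.finite_Iic (fun _ : Fin k => n)).subset ?_
  intro a ha i
  have h : ∑ j, a j = n := ha
  rw [← h]
  exact Finset.single_le_sum (fun j _ => Nat.zero_le (a j)) (Finset.mem_univ i)

/-! Let f(z) = ∑_{a ∈ A} z^a. The generating function H of the representation counts is the complete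
homogeneous (for ≤) or elementary symmetric (for <) sum of degree k in the variables z^a, a ∈ A,
whose power sums are f(z^j). If the counts are eventually constant, (1 - z)H(z) is a polynomial,
hence bounded on the unit disc.

By Newton's identities k!·H is f(z)^k plus terms containing some f(z^j) with j ≥ 2. So either f(z)
is dominated by the f(z^j), on the scale |f(z^j)|^(1/j), or |f(z)|^k is at most a constant times
|H(z)|. In both cases |(1 - z)f(z)|² ≤ C + E(1 + ∑_{2≤j≤k} |f(z^j)|)
(`NewtonRel.norm_sq_one_sub_mul_genFun_le`).

Integrate over |z| = x and put M = ∑_{a ∈ A} x^(2a). By Parseval the left side becomes the weighted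
number of jumps of the indicator of A, while f(z^j) has mean square at most M and enters only to the
first power, so the right side is at most ηM + O_η(1) with η as small as desired
(`tsum_backwardDiff_le`). On the other hand A has no long runs of consecutive elements, so the jumps
control M up to constants (`tsum_indicator_le_tsum_backwardDiff`). Hence M stays bounded as x → 1,
which is impossible for infinite A. -/

/-! ### Size estimates from Newton-type recurrences -/

open Finset in
/-- Newton-type recurrences force `‖h m‖` to be at most the `m`-th power of `‖q 1‖ + T`. -/
theorem norm_le_of_newton {h q : ℕ → ℂ} {k : ℕ} {T : ℝ} (hT : 0 ≤ T) (h0 : h 0 = 1)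
    (hrec : ∀ m : ℕ, ((m : ℂ) + 1) * h (m + 1) = ∑ i ∈ range (m + 1), h (m - i) * q (i + 1))
    (hq : ∀ j, 2 ≤ j → j ≤ k → ‖q j‖ ≤ T ^ j) (m : ℕ) (hm : m ≤ k) :
    ‖h m‖ ≤ (‖q 1‖ + T) ^ m := by
  induction m using Nat.strong_induction_on with
  | _ m ih =>
    rcases m with _ | m
    · simp [h0]
    · have hs : 0 ≤ ‖q 1‖ := norm_nonneg _
      have hbound : ∀ j, 1 ≤ j → j ≤ k → ‖q j‖ ≤ (‖q 1‖ + T) ^ j := by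
        intro j hj1 hjk
        rcases hj1.eq_or_lt with rfl | hj
        · simpa using hT
        · exact (hq j hj hjk).trans (pow_le_pow_left₀ hT (by linarith) j)
      have h1 : ((m : ℝ) + 1) * ‖h (m + 1)‖ ≤ ((m : ℝ) + 1) * (‖q 1‖ + T) ^ (m + 1) := by
        have h2 : ‖((m : ℂ) + 1) * h (m + 1)‖ = ((m : ℝ) + 1) * ‖h (m + 1)‖ := by
          rw [norm_mul]; congr 1; exact_mod_cast Complex.norm_natCast (m + 1)
        rw [← h2, hrec m]
        refine (norm_sum_le _ _).trans ?_
        have h3 : ∀ i ∈ range (m + 1), ‖h (m - i) * q (i + 1)‖ ≤ (‖q 1‖ + T) ^ (m + 1) := by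
          intro i hi
          have hi' : i ≤ m := by simpa [Nat.lt_succ_iff] using hi
          rw [norm_mul, show m + 1 = (m - i) + (i + 1) by omega, pow_add]
          gcongr
          · simpa [show m - i + (i + 1) = m + 1 by omega] using
              ih (m - i) (by omega) (by omega)
          · exact hbound _ (by omega) (by omega)
        refine (sum_le_card_nsmul _ _ _ h3).trans (le_of_eq ?_)
        simp
      exact le_of_mul_le_mul_left h1 (by positivity)

-- Unfolding the recurrence, (m+1)!·h (m+1) is q 1 ^ (m+1) plus products containing some q j with j
-- ≥ 2, and each of these gains a factor T. The induction isolates the i = 0 term, which carries q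
-- 1, and bounds the other terms by `norm_le_of_newton`.
open Finset Nat in
theorem norm_factorial_mul_sub_pow_le_of_newton {h q : ℕ → ℂ} {k : ℕ} {T : ℝ} (hT : 0 ≤ T)
    (h0 : h 0 = 1)
    (hrec : ∀ m : ℕ, ((m : ℂ) + 1) * h (m + 1) = ∑ i ∈ range (m + 1), h (m - i) * q (i + 1))
    (hq : ∀ j, 2 ≤ j → j ≤ k → ‖q j‖ ≤ T ^ j) (m : ℕ) (hm : m + 1 ≤ k) :
    ‖((m + 1)! : ℂ) * h (m + 1) - q 1 ^ (m + 1)‖ ≤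
      ((m + 1)! : ℝ) * (m + 1) * (T * (‖q 1‖ + T) ^ m) := by
  have hs : 0 ≤ ‖q 1‖ := norm_nonneg _
  induction m with
  | zero =>
    have h1 := hrec 0
    simp [h0] at h1
    simp [h1, hT]
  | succ m ih =>
    specialize ih (by omega)
    have hexp : ((m + 1 + 1)! : ℂ) * h (m + 1 + 1) - q 1 ^ (m + 1 + 1) =
        q 1 * (((m + 1)! : ℂ) * h (m + 1) - q 1 ^ (m + 1)) +
          ((m + 1)! : ℂ) * ∑ i ∈ range (m + 1), h (m - i) * q (i + 1 + 1) := by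
      have h1 := hrec (m + 1)
      rw [sum_range_succ'] at h1
      simp only [Nat.add_sub_add_right, tsub_zero, zero_add] at h1
      rw [Nat.factorial_succ (m + 1)]
      push_cast at h1 ⊢
      linear_combination ((m + 1)! : ℂ) * h1
    have hsum : ‖∑ i ∈ range (m + 1), h (m - i) * q (i + 1 + 1)‖ ≤
        ((m : ℝ) + 1) * (T * (‖q 1‖ + T) ^ (m + 1)) := by
      refine (norm_sum_le _ _).trans ?_
      have h3 : ∀ i ∈ range (m + 1), ‖h (m - i) * q (i + 1 + 1)‖ ≤
          T * (‖q 1‖ + T) ^ (m + 1) := by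
        intro i hi
        have hi' : i ≤ m := by simpa [Nat.lt_succ_iff] using hi
        have ha := norm_le_of_newton hT h0 hrec hq (m - i) (by omega)
        have hb := hq (i + 1 + 1) (by omega) (by omega)
        have hc : T ^ (i + 1) ≤ (‖q 1‖ + T) ^ (i + 1) := pow_le_pow_left₀ hT (by linarith) _
        calc ‖h (m - i) * q (i + 1 + 1)‖ = ‖h (m - i)‖ * ‖q (i + 1 + 1)‖ := norm_mul _ _
          _ ≤ (‖q 1‖ + T) ^ (m - i) * T ^ (i + 1 + 1) := by gcongr
          _ = T * ((‖q 1‖ + T) ^ (m - i) * T ^ (i + 1)) := by ring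
          _ ≤ T * ((‖q 1‖ + T) ^ (m - i) * (‖q 1‖ + T) ^ (i + 1)) := by gcongr
          _ = T * (‖q 1‖ + T) ^ (m + 1) := by
            rw [← pow_add, show m - i + (i + 1) = m + 1 by omega]
      refine (sum_le_card_nsmul _ _ _ h3).trans (le_of_eq ?_)
      simp
    rw [hexp]
    refine (norm_add_le _ _).trans ?_
    rw [norm_mul, norm_mul, Complex.norm_natCast]
    set F : ℝ := ((m + 1)! : ℝ) with hF
    set U : ℝ := T * (‖q 1‖ + T) ^ (m + 1) with hU
    have hU0 : 0 ≤ U := by positivity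
    have hF0 : 0 ≤ F := by positivity
    have h4 : ‖q 1‖ * (F * ((m : ℝ) + 1) * (T * (‖q 1‖ + T) ^ m)) ≤ F * ((m : ℝ) + 1) * U := by
      have h5 : ‖q 1‖ * (T * (‖q 1‖ + T) ^ m) ≤ U := by
        rw [hU, pow_succ]
        have : ‖q 1‖ * (T * (‖q 1‖ + T) ^ m) ≤ (‖q 1‖ + T) * (T * (‖q 1‖ + T) ^ m) := by
          gcongr; linarith
        linarith
      calc _ = F * ((m : ℝ) + 1) * (‖q 1‖ * (T * (‖q 1‖ + T) ^ m)) := by ring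
        _ ≤ _ := by gcongr
    have h6 : ‖q 1‖ * ‖((m + 1)! : ℂ) * h (m + 1) - q 1 ^ (m + 1)‖ ≤
        F * ((m : ℝ) + 1) * U := (mul_le_mul_of_nonneg_left ih hs).trans h4
    have h7 := mul_le_mul_of_nonneg_left hsum hF0
    have h8 : (((m + 1 + 1)! : ℕ) : ℝ) = (m + 2) * F := by
      rw [Nat.factorial_succ (m + 1), hF]; push_cast; ring
    rw [h8]
    push_cast
    have h9 : 0 ≤ F * U := by positivity
    have h10 : 0 ≤ (m : ℝ) * (F * U) := by positivity
    have h11 : 0 ≤ (m : ℝ) * ((m : ℝ) * (F * U)) := by positivity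
    nlinarith

open Finset Nat in
/-- Either the first power sum is controlled by the higher ones, or it is controlled by `h k`. -/
theorem norm_le_or_pow_le_of_newton {h q : ℕ → ℂ} {k : ℕ} (hk : 1 ≤ k) {T : ℝ} (hT : 0 ≤ T)
    (h0 : h 0 = 1)
    (hrec : ∀ m : ℕ, ((m : ℂ) + 1) * h (m + 1) = ∑ i ∈ range (m + 1), h (m - i) * q (i + 1))
    (hq : ∀ j, 2 ≤ j → j ≤ k → ‖q j‖ ≤ T ^ j) :
    ‖q 1‖ ≤ ((k ! : ℝ) * k * 2 ^ k) * T ∨ ‖q 1‖ ^ k ≤ 2 * (k ! : ℝ) * ‖h k‖ := by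
  obtain ⟨m, rfl⟩ : ∃ m, k = m + 1 := ⟨k - 1, by omega⟩
  rcases le_or_gt ‖q 1‖ ((((m + 1)! : ℕ) : ℝ) * ((m + 1 : ℕ) : ℝ) * 2 ^ (m + 1) * T) with h1 | h1
  · exact Or.inl h1
  right
  have hE := norm_factorial_mul_sub_pow_le_of_newton hT h0 hrec hq m le_rfl
  have hs : 0 ≤ ‖q 1‖ := norm_nonneg _
  push_cast at h1
  set F : ℝ := ((m + 1)! : ℝ) with hF
  have hF1 : 1 ≤ F := by rw [hF]; exact_mod_cast Nat.one_le_iff_ne_zero.2 (Nat.factorial_ne_zero _)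
  have hm0 : (0 : ℝ) ≤ m := by positivity
  have hp1 : (1 : ℝ) ≤ 2 ^ (m + 1) := one_le_pow₀ (by norm_num)
  -- When q 1 dominates T by this large factor, the error term is at most half of ‖q 1‖ ^ (m+1) and
  -- can be absorbed.
  have hTs : T ≤ ‖q 1‖ := by
    have : (1 : ℝ) ≤ F * (m + 1) * 2 ^ (m + 1) := by
      have : (1 : ℝ) ≤ F * (m + 1) := by nlinarith
      nlinarith
    nlinarith
  have h2 : (‖q 1‖ + T) ^ m ≤ 2 ^ m * ‖q 1‖ ^ m := by
    rw [← mul_pow]; exact pow_le_pow_left₀ (by positivity) (by linarith) _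
  have h3 : F * (m + 1) * (T * (‖q 1‖ + T) ^ m) ≤ ‖q 1‖ ^ (m + 1) / 2 := by
    calc F * (m + 1) * (T * (‖q 1‖ + T) ^ m) ≤ F * (m + 1) * (T * (2 ^ m * ‖q 1‖ ^ m)) := by gcongr
      _ = (F * (m + 1) * 2 ^ (m + 1) * T) * ‖q 1‖ ^ m / 2 := by ring
      _ ≤ ‖q 1‖ * ‖q 1‖ ^ m / 2 := by gcongr
      _ = _ := by ring
  have h4 : ‖q 1‖ ^ (m + 1) ≤ F * ‖h (m + 1)‖ +
      ‖((m + 1)! : ℂ) * h (m + 1) - q 1 ^ (m + 1)‖ := by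
    have h5 := norm_sub_norm_le (q 1 ^ (m + 1)) (((m + 1)! : ℂ) * h (m + 1))
    rw [norm_mul, Complex.norm_natCast, norm_pow, norm_sub_rev] at h5
    linarith
  linarith

/-! ### Newton's identities through logarithmic derivatives -/

open PowerSeries in
theorem derivative_prod_eq {R ι : Type*} [CommRing R] (S : Finset ι) (F G : ι → R⟦X⟧)
    (h : ∀ a ∈ S, d⁄dX R (F a) = F a * G a) :
    d⁄dX R (∏ a ∈ S, F a) = (∏ a ∈ S, F a) * ∑ a ∈ S, G a := by
  classical
  induction S using Finset.induction_on with
  | empty => simp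
  | insert a S ha ih =>
    rw [Finset.prod_insert ha, Finset.sum_insert ha, Derivation.leibniz,
      ih fun b hb => h b (Finset.mem_insert_of_mem hb), h a (Finset.mem_insert_self a S)]
    simp only [smul_eq_mul]
    ring

-- Comparing coefficients in F' = F·G is Newton's recurrence, with the coefficients of the
-- logarithmic derivative G as signed power sums.
open PowerSeries in
theorem coeff_succ_of_derivative_eq {R : Type*} [CommRing R] {F G : R⟦X⟧}
    (h : d⁄dX R F = F * G) (m : ℕ) :
    ((m : R) + 1) * coeff (m + 1) F =
      ∑ i ∈ Finset.range (m + 1), coeff (m - i) F * coeff i G := by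
  have h1 := congrArg (coeff m) h
  rw [coeff_derivative, coeff_mul, ← Finset.Nat.sum_antidiagonal_swap,
    Finset.Nat.sum_antidiagonal_eq_sum_range_succ_mk] at h1
  rw [mul_comm, h1]
  rfl

open PowerSeries in
theorem derivative_mk_pow {R : Type*} [CommRing R] (x : R) :
    d⁄dX R (mk fun i => x ^ i) = (mk fun i => x ^ i) * mk fun i => x ^ (i + 1) := by
  ext m
  rw [coeff_derivative, coeff_mul]
  simp only [coeff_mk]
  rw [Finset.sum_congr rfl (g := fun _ => x ^ (m + 1))]
  · simp [mul_comm]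
  · intro p hp
    rw [Finset.HasAntidiagonal.mem_antidiagonal] at hp
    rw [← pow_add, ← hp, add_assoc]

open PowerSeries in
theorem derivative_one_add_C_mul_X {R : Type*} [CommRing R] (x : R) :
    d⁄dX R (1 + C x * X) = (1 + C x * X) * mk fun i => (-1) ^ i * x ^ (i + 1) := by
  have hd : d⁄dX R (1 + C x * X) = C x := by
    rw [map_add, Derivation.leibniz, derivative_C, derivative_X]
    simp
  ext m
  rw [hd, add_mul, one_mul, mul_assoc, map_add (coeff m), coeff_C_mul]
  rcases m with _ | m
  · simp
  · rw [coeff_succ_X_mul]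
    simp
    ring

open Classical in
/-- The sum of `∏ i, x (a i)` over the tuples `a` in `S` whose entries are pairwise related. -/
noncomputable def relTupleSum {R : Type*} [CommRing R] (r : ℕ → ℕ → Prop) (x : ℕ → R)
    (S : Finset ℕ) (m : ℕ) : R :=
  ∑ a ∈ (Fintype.piFinset fun _ : Fin m => S) with ∀ i j, i < j → r (a i) (a j), ∏ i, x (a i)

theorem relTupleSum_zero {R : Type*} [CommRing R] (r : ℕ → ℕ → Prop) (x : ℕ → R)
    (S : Finset ℕ) : relTupleSum r x S 0 = 1 := by
  simp [relTupleSum]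

theorem relTupleSum_empty_succ {R : Type*} [CommRing R] (r : ℕ → ℕ → Prop) (x : ℕ → R)
    (m : ℕ) : relTupleSum r x ∅ (m + 1) = 0 := by
  simp [relTupleSum]

-- Split on whether the last entry is b. Since b is related to no element of S, a tuple using b must
-- end in b. The set S' holds the entries allowed before a final b: `insert b S` for ≤, and S for <.
open Classical in
theorem relTupleSum_insert_succ {R : Type*} [CommRing R] (r : ℕ → ℕ → Prop) (x : ℕ → R)
    (S : Finset ℕ) (b : ℕ) (hb : b ∉ S) (hrb : ∀ c ∈ S, ¬ r b c) (S' : Finset ℕ)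
    (hS' : ∀ c, c ∈ S' ↔ c ∈ insert b S ∧ r c b) (m : ℕ) :
    relTupleSum r x (insert b S) (m + 1) = relTupleSum r x S (m + 1) +
      x b * relTupleSum r x S' m := by
  unfold relTupleSum
  rw [← Finset.sum_filter_not_add_sum_filter _ (fun a => a (Fin.last m) = b), Finset.mul_sum]
  congr 1
  · refine Finset.sum_congr ?_ fun _ _ => rfl
    ext a
    simp only [Finset.mem_filter, Fintype.mem_piFinset, Finset.mem_insert]
    constructor
    · rintro ⟨⟨h1, h2⟩, h3⟩
      refine ⟨fun i => ?_, h2⟩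
      rcases h1 i with h | h
      · exfalso
        have hl := (h1 (Fin.last m)).resolve_left h3
        rcases (Fin.le_last i).eq_or_lt with rfl | hi
        · exact h3 h
        · exact hrb _ hl (h ▸ h2 i _ hi)
      · exact h
    · rintro ⟨h1, h2⟩
      exact ⟨⟨fun i => Or.inr (h1 i), h2⟩, fun h => hb (h ▸ h1 _)⟩
  · refine Finset.sum_bij' (fun a _ => Fin.init a)
      (fun a _ => (Fin.snoc a b : Fin (m + 1) → ℕ)) ?_ ?_ ?_ ?_ ?_
    · intro a ha
      simp only [Finset.mem_filter, Fintype.mem_piFinset, hS'] at ha ⊢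
      obtain ⟨⟨h1, h2⟩, h3⟩ := ha
      refine ⟨fun i => ⟨h1 _, ?_⟩, fun i j hij => h2 _ _ (by simpa using hij)⟩
      rw [← h3]
      exact h2 _ _ (Fin.castSucc_lt_last i)
    · intro a ha
      simp only [Finset.mem_filter, Fintype.mem_piFinset, hS'] at ha ⊢
      obtain ⟨h1, h2⟩ := ha
      refine ⟨⟨fun i => ?_, fun i j hij => ?_⟩, by simp⟩
      · refine Fin.lastCases ?_ (fun i => ?_) i
        · simp
        · simpa using (h1 i).1
      · induction i using Fin.lastCases with
        | last => exact absurd hij (not_lt.2 (Fin.le_last j))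
        | cast i =>
          induction j using Fin.lastCases with
          | last => simpa using (h1 i).2
          | cast j => simpa using h2 i j (by simpa using hij)
    · intro a ha
      simp only [Finset.mem_filter] at ha
      rw [← ha.2]
      exact Fin.snoc_init_self a
    · intro a ha
      exact Fin.init_snoc _ _
    · intro a ha
      simp only [Finset.mem_filter] at ha
      rw [Fin.prod_univ_castSucc, ha.2, mul_comm]
      rfl

open PowerSeries in
theorem coeff_prod_mk_pow {R : Type*} [CommRing R] (x : ℕ → R) (S : Finset ℕ) (m : ℕ) :
    coeff m (∏ a ∈ S, mk fun i => x a ^ i) = relTupleSum (· ≤ ·) x S m := by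
  induction S using Finset.induction_on_max generalizing m with
  | empty =>
    rcases m with _ | m
    · simp [relTupleSum_zero]
    · simp [relTupleSum_empty_succ, coeff_one]
  | insert b S hb ih =>
    have hbS : b ∉ S := fun h => lt_irrefl _ (hb b h)
    have hgeom : (mk fun i => x b ^ i : R⟦X⟧) = 1 + C (x b) * (X * mk fun i => x b ^ i) := by
      ext n
      rw [map_add (coeff n), coeff_C_mul]
      rcases n with _ | n
      · simp
      · rw [coeff_succ_X_mul]
        simp [coeff_one, pow_succ']
    have hprod : (∏ a ∈ insert b S, mk fun i => x a ^ i : R⟦X⟧) = (∏ a ∈ S, mk fun i => x a ^ i) +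
        C (x b) * (X * ∏ a ∈ insert b S, mk fun i => x a ^ i) := by
      rw [Finset.prod_insert hbS]
      linear_combination (∏ a ∈ S, mk fun i => x a ^ i : R⟦X⟧) * hgeom
    -- For ≤ the maximum b may repeat, so the recurrence returns to `insert b S` in degree m; hence
    -- an inner induction on the degree.
    induction m with
    | zero => simp [relTupleSum_zero, map_prod]
    | succ m ihm =>
      rw [relTupleSum_insert_succ _ _ _ _ hbS (fun c hc => not_le.2 (hb c hc)) (insert b S),
        hprod, map_add (coeff (m + 1)), coeff_C_mul, coeff_succ_X_mul, ihm, ih]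
      simpa using fun a ha => (hb a ha).le

open PowerSeries in
theorem coeff_prod_one_add {R : Type*} [CommRing R] (x : ℕ → R) (S : Finset ℕ) (m : ℕ) :
    coeff m (∏ a ∈ S, (1 + C (x a) * X)) = relTupleSum (· < ·) x S m := by
  induction S using Finset.induction_on_max generalizing m with
  | empty =>
    rcases m with _ | m
    · simp [relTupleSum_zero]
    · simp [relTupleSum_empty_succ, coeff_one]
  | insert b S hb ih =>
    have hbS : b ∉ S := fun h => lt_irrefl _ (hb b h)
    rcases m with _ | m
    · simp [relTupleSum_zero, map_prod]
    · rw [relTupleSum_insert_succ _ _ _ _ hbS (fun c hc => not_lt.2 (hb c hc).le) S,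
        Finset.prod_insert hbS, add_mul, one_mul, mul_assoc, map_add (coeff (m + 1)), coeff_C_mul,
        coeff_succ_X_mul, ih, ih]
      intro c
      rw [Finset.mem_insert]
      constructor
      · exact fun hc => ⟨Or.inr hc, hb c hc⟩
      · rintro ⟨rfl | hc, h⟩
        · exact absurd h (lt_irrefl _)
        · exact hc

/-- Newton's identities for complete homogeneous sums (`ε = 1`) and elementary symmetric sums
(`ε = -1`) over a finite set of naturals. -/
def NewtonRel (r : ℕ → ℕ → Prop) (ε : ℂ) : Prop :=
  ∀ (x : ℕ → ℂ) (S : Finset ℕ) (m : ℕ), ((m : ℂ) + 1) * relTupleSum r x S (m + 1) =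
    ∑ i ∈ Finset.range (m + 1), relTupleSum r x S (m - i) * (ε ^ i * ∑ a ∈ S, x a ^ (i + 1))

open PowerSeries in
theorem newtonRel_le : NewtonRel (· ≤ ·) 1 := by
  intro x S m
  have h := coeff_succ_of_derivative_eq (derivative_prod_eq S (fun a => mk fun i => x a ^ i)
    _ fun a _ => derivative_mk_pow (x a)) m
  simpa [coeff_prod_mk_pow] using h

open PowerSeries in
theorem newtonRel_lt : NewtonRel (· < ·) (-1) := by
  intro x S m
  have h := coeff_succ_of_derivative_eq (derivative_prod_eq S (fun a => 1 + C (x a) * X)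
    _ fun a _ => derivative_one_add_C_mul_X (x a)) m
  simpa only [coeff_prod_one_add, map_sum, coeff_mk, Finset.mul_sum] using h

open Nat in
theorem NewtonRel.norm_le_or_pow_le {r : ℕ → ℕ → Prop} {ε : ℂ} (hr : NewtonRel r ε) (hε : ‖ε‖ = 1)
    {k : ℕ} (hk : 1 ≤ k) {T : ℝ} (hT : 0 ≤ T) (x : ℕ → ℂ) (S : Finset ℕ)
    (hp : ∀ j, 2 ≤ j → j ≤ k → ‖∑ a ∈ S, x a ^ j‖ ≤ T ^ j) :
    ‖∑ a ∈ S, x a‖ ≤ ((k ! : ℝ) * k * 2 ^ k) * T ∨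
      ‖∑ a ∈ S, x a‖ ^ k ≤ 2 * (k ! : ℝ) * ‖relTupleSum r x S k‖ := by
  have h := norm_le_or_pow_le_of_newton (h := relTupleSum r x S)
    -- At j = 1 the sign factor is ε ^ 0, so q 1 is the plain sum.
    (q := fun j => ε ^ (j - 1) * ∑ a ∈ S, x a ^ j) hk hT (relTupleSum_zero _ _ _)
    (fun m => by simpa using hr x S m) (fun j h2 hjk => by simpa [hε] using hp j h2 hjk)
  simpa using h

/-! ### Passage from finite sets to generating functions -/

open Filter Topology

/-- The number of tuples in `A` with pairwise related entries and sum `n`. -/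
noncomputable def relRep (r : ℕ → ℕ → Prop) (k : ℕ) (A : Set ℕ) (n : ℕ) : ℕ :=
  Set.ncard {a : Fin k → ℕ | (∀ i, a i ∈ A) ∧ (∀ i j, i < j → r (a i) (a j)) ∧ ∑ i, a i = n}

theorem finite_relRep (r : ℕ → ℕ → Prop) (k : ℕ) (A : Set ℕ) (n : ℕ) :
    {a : Fin k → ℕ | (∀ i, a i ∈ A) ∧ (∀ i j, i < j → r (a i) (a j)) ∧
      ∑ i, a i = n}.Finite :=
  (finite_tuples_sum_eq k n).subset fun _ ha => ha.2.2

theorem relRep_mono (r : ℕ → ℕ → Prop) (k : ℕ) {A B : Set ℕ} (h : A ⊆ B) (n : ℕ) :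
    relRep r k A n ≤ relRep r k B n :=
  Set.ncard_le_ncard (fun _ ha => ⟨fun i => h (ha.1 i), ha.2⟩) (finite_relRep r k B n)

theorem relRep_inter_Iio (r : ℕ → ℕ → Prop) (k : ℕ) (A : Set ℕ) {n L : ℕ} (h : n < L) :
    relRep r k (A ∩ Set.Iio L) n = relRep r k A n := by
  unfold relRep
  congr 1
  ext a
  constructor
  · exact fun ha => ⟨fun i => (ha.1 i).1, ha.2⟩
  · rintro ⟨h1, h2, h3⟩
    refine ⟨fun i => ⟨h1 i, lt_of_le_of_lt ?_ h⟩, h2, h3⟩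
    rw [← h3]
    exact Finset.single_le_sum (fun j _ => Nat.zero_le (a j)) (Finset.mem_univ i)

theorem sum_pow_eq_tsum_card_mul_pow {ι : Type*} [DecidableEq ι] (F : Finset ι) (g : ι → ℕ)
    (z : ℂ) : ∑ a ∈ F, z ^ g a = ∑' n : ℕ, ((F.filter fun a => g a = n).card : ℂ) * z ^ n := by
  rw [tsum_eq_sum (s := F.image g)]
  · rw [← Finset.sum_fiberwise_of_maps_to (fun a ha => Finset.mem_image_of_mem g ha)]
    refine Finset.sum_congr rfl fun n _ => ?_
    rw [Finset.sum_congr rfl (g := fun _ => z ^ n), Finset.sum_const, nsmul_eq_mul]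
    intro a ha
    rw [(Finset.mem_filter.1 ha).2]
  · intro n hn
    rw [Finset.filter_false_of_mem]
    · simp
    · rintro a ha rfl
      exact hn (Finset.mem_image_of_mem g ha)

theorem relTupleSum_pow_eq_tsum (r : ℕ → ℕ → Prop) (k : ℕ) (S : Finset ℕ) (z : ℂ) :
    relTupleSum r (fun a => z ^ a) S k = ∑' n : ℕ, (relRep r k (S : Set ℕ) n : ℂ) * z ^ n := by
  classical
  unfold relTupleSum
  simp only [Finset.prod_pow_eq_pow_sum]
  rw [sum_pow_eq_tsum_card_mul_pow]
  congr 1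
  ext n
  congr 2
  rw [relRep, ← Set.ncard_coe_finset]
  congr 1
  ext a
  simp [and_assoc]

-- Truncating A at L leaves the coefficients below L unchanged, and all coefficients are dominated
-- by B, so dominated convergence applies.
open Classical in
theorem tendsto_relTupleSum {r : ℕ → ℕ → Prop} {k : ℕ} {A : Set ℕ} {B : ℕ}
    (hB : ∀ n, relRep r k A n ≤ B) {z : ℂ} (hz : ‖z‖ < 1) :
    Tendsto (fun L => relTupleSum r (fun a => z ^ a) ((Finset.range L).filter (· ∈ A)) k) atTop
      (𝓝 (∑' n : ℕ, (relRep r k A n : ℂ) * z ^ n)) := by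
  have hS : ∀ L, (((Finset.range L).filter (· ∈ A) : Finset ℕ) : Set ℕ) = A ∩ Set.Iio L := by
    intro L
    ext a
    simp [and_comm]
  simp only [relTupleSum_pow_eq_tsum, hS]
  refine tendsto_tsum_of_dominated_convergence (bound := fun n => (B : ℝ) * ‖z‖ ^ n)
    ((summable_geometric_of_lt_one (norm_nonneg z) hz).mul_left _) ?_ ?_
  · intro n
    refine tendsto_const_nhds.congr' ?_
    filter_upwards [eventually_gt_atTop n] with L hL
    rw [relRep_inter_Iio r k A hL]
  · refine Eventually.of_forall fun L n => ?_
    rw [norm_mul, norm_pow, Complex.norm_natCast]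
    gcongr
    exact (relRep_mono r k Set.inter_subset_left n).trans (hB n)

/-- The generating function of `A`. -/
noncomputable def genFun (A : Set ℕ) (z : ℂ) : ℂ := ∑' n, A.indicator (fun _ => (1 : ℂ)) n * z ^ n

theorem summable_norm_mul_pow {b : ℕ → ℂ} {B : ℝ} (hb : ∀ n, ‖b n‖ ≤ B) {z : ℂ} (hz : ‖z‖ < 1) :
    Summable fun n => ‖b n * z ^ n‖ := by
  refine Summable.of_nonneg_of_le (fun _ => norm_nonneg _) (fun n => ?_)
    ((summable_geometric_of_lt_one (norm_nonneg z) hz).mul_left B)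
  rw [norm_mul, norm_pow]
  gcongr
  exact hb n

theorem norm_indicator_one_le (A : Set ℕ) (n : ℕ) :
    ‖A.indicator (fun _ => (1 : ℂ)) n‖ ≤ 1 := by
  by_cases h : n ∈ A <;> simp [h]

open Classical in
theorem tendsto_sum_pow_genFun (A : Set ℕ) {z : ℂ} (hz : ‖z‖ < 1) :
    Tendsto (fun L => ∑ a ∈ (Finset.range L).filter (· ∈ A), z ^ a) atTop (𝓝 (genFun A z)) := by
  have h := (summable_norm_mul_pow (norm_indicator_one_le A) hz).of_norm.hasSum.tendsto_sum_nat
  refine h.congr fun L => ?_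
  rw [Finset.sum_filter]
  exact Finset.sum_congr rfl fun a _ => by by_cases ha : a ∈ A <;> simp [ha]

-- Newton's identities are applied to truncations of A. The strict bounds in `hp` survive for large
-- truncations. Which alternative holds may vary with L, but one of them holds frequently, which
-- suffices for the limit.
open Nat in
theorem NewtonRel.genFun_le_or_pow_le {r : ℕ → ℕ → Prop} {ε : ℂ} (hr : NewtonRel r ε)
    (hε : ‖ε‖ = 1) {k : ℕ} (hk : 1 ≤ k) {A : Set ℕ} {B : ℕ} (hB : ∀ n, relRep r k A n ≤ B)
    {z : ℂ} (hz : ‖z‖ < 1) {T : ℝ} (hT : 0 ≤ T)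
    (hp : ∀ j, 2 ≤ j → j ≤ k → ‖genFun A (z ^ j)‖ < T ^ j) :
    ‖genFun A z‖ ≤ ((k ! : ℝ) * k * 2 ^ k) * T ∨
      ‖genFun A z‖ ^ k ≤ 2 * (k ! : ℝ) * ‖∑' n : ℕ, (relRep r k A n : ℂ) * z ^ n‖ := by
  classical
  have hzj : ∀ j, 2 ≤ j → ‖z ^ j‖ < 1 := fun j hj => by
    rw [norm_pow]; exact pow_lt_one₀ (norm_nonneg z) hz (by omega)
  have hev : ∀ᶠ L in atTop, ∀ j ∈ Finset.Icc 2 k,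
      ‖∑ a ∈ (Finset.range L).filter (· ∈ A), (z ^ a) ^ j‖ ≤ T ^ j := by
    rw [Finset.eventually_all]
    intro j hj
    rw [Finset.mem_Icc] at hj
    have h1 := (tendsto_sum_pow_genFun A (hzj j hj.1)).norm.eventually_lt_const (hp j hj.1 hj.2)
    filter_upwards [h1] with L hL
    simpa only [← pow_mul, mul_comm] using hL.le
  have hdich : ∃ᶠ L in atTop,
      ‖∑ a ∈ (Finset.range L).filter (· ∈ A), z ^ a‖ ≤ ((k ! : ℝ) * k * 2 ^ k) * T ∨
      ‖∑ a ∈ (Finset.range L).filter (· ∈ A), z ^ a‖ ^ k ≤ 2 * (k ! : ℝ) *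
        ‖relTupleSum r (fun a => z ^ a) ((Finset.range L).filter (· ∈ A)) k‖ := by
    refine Eventually.frequently ?_
    filter_upwards [hev] with L hL
    exact hr.norm_le_or_pow_le hε hk hT _ _ fun j h2 hj => hL j (Finset.mem_Icc.2 ⟨h2, hj⟩)
  have h1 := (tendsto_sum_pow_genFun A hz).norm
  rcases frequently_or_distrib.1 hdich with h | h
  · exact Or.inl (le_of_tendsto_of_frequently h1 h)
  · refine Or.inr ?_
    by_contra! hlt
    exact h (((((tendsto_relTupleSum hB hz).norm.const_mul _).eventually_lt (h1.pow k) hlt)).mono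
      fun L hL => not_le.2 hL)

/-! ### Parseval's identity -/

open Complex in
theorem integral_exp_sub_mul_I (m n : ℕ) :
    ∫ θ in (0 : ℝ)..2 * Real.pi, exp (m * θ * I) * (starRingEnd ℂ) (exp (n * θ * I)) =
      if m = n then (2 * Real.pi : ℂ) else 0 := by
  have h1 : ∀ θ : ℝ, exp (m * θ * I) * (starRingEnd ℂ) (exp (n * θ * I)) =
      exp (((m : ℂ) - n) * I * θ) := by
    intro θ
    rw [← exp_conj, ← exp_add]
    congr 1
    simp
    ring
  simp only [h1]
  split_ifs with h
  · simp [h]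
  · have hc : ((m : ℂ) - n) * I ≠ 0 :=
      mul_ne_zero (sub_ne_zero.2 (by exact_mod_cast h)) I_ne_zero
    rw [integral_exp_mul_complex hc]
    have h2 : ((m : ℂ) - n) * I * ((2 * Real.pi : ℝ) : ℂ) =
        ((m : ℤ) - (n : ℤ) : ℤ) * (2 * Real.pi * I) := by
      push_cast; ring
    rw [h2, exp_int_mul_two_pi_mul_I]
    simp

open Complex in
/-- Parseval's identity for an absolutely convergent trigonometric series. -/
theorem integral_norm_sq_tsum {b : ℕ → ℂ} (hb : Summable fun n => ‖b n‖) {e : ℕ → ℕ}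
    (he : Function.Injective e) :
    ∫ θ in (0 : ℝ)..2 * Real.pi, ‖∑' n, b n * exp (e n * θ * I)‖ ^ 2 =
      2 * Real.pi * ∑' n, ‖b n‖ ^ 2 := by
  set F : ℕ → ℝ → ℂ := fun n θ => b n * exp (e n * θ * I) with hF
  have hnorm : ∀ n θ, ‖F n θ‖ = ‖b n‖ := by
    intro n θ
    rw [hF]
    simp only [norm_mul]
    rw [show (e n : ℂ) * θ * I = ((e n * θ : ℝ) : ℂ) * I by push_cast; ring, norm_exp_ofReal_mul_I,
      mul_one]
  have hsum : ∀ θ, Summable fun n => ‖F n θ‖ := fun θ => by simpa only [hnorm] using hb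
  have hprod : ∀ θ, HasSum (fun p : ℕ × ℕ => F p.1 θ * (starRingEnd ℂ) (F p.2 θ))
      ((‖∑' n, F n θ‖ ^ 2 : ℝ) : ℂ) := by
    intro θ
    have hs2 : Summable fun n => ‖(starRingEnd ℂ) (F n θ)‖ := by
      simpa only [RCLike.norm_conj] using hsum θ
    have h1 := (summable_mul_of_summable_norm (hsum θ) hs2).hasSum
    rwa [← tsum_mul_tsum_of_summable_norm (hsum θ) hs2, ← conj_tsum, mul_conj, normSq_eq_norm_sq] at h1
  have hint := intervalIntegral.hasSum_integral_of_dominated_convergence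
    (μ := MeasureTheory.volume) (a := 0) (b := 2 * Real.pi)
    (F := fun (p : ℕ × ℕ) θ => F p.1 θ * (starRingEnd ℂ) (F p.2 θ))
    (f := fun θ => ((‖∑' n, F n θ‖ ^ 2 : ℝ) : ℂ))
    (fun p _ => ‖b p.1‖ * ‖b p.2‖)
    (fun p => by
      apply Continuous.aestronglyMeasurable
      simp only [hF]
      fun_prop)
    (fun p => Eventually.of_forall fun θ _ => by
      rw [norm_mul, RCLike.norm_conj, hnorm, hnorm])
    (Eventually.of_forall fun θ _ => hb.mul_of_nonneg hb (fun _ => norm_nonneg _)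
      fun _ => norm_nonneg _)
    intervalIntegrable_const
    (Eventually.of_forall fun θ _ => hprod θ)
  have hterm : ∀ p : ℕ × ℕ, ∫ θ in (0 : ℝ)..2 * Real.pi, F p.1 θ * (starRingEnd ℂ) (F p.2 θ) =
      if p.1 = p.2 then ((2 * Real.pi * ‖b p.1‖ ^ 2 : ℝ) : ℂ) else 0 := by
    intro p
    have h1 : ∀ θ : ℝ, F p.1 θ * (starRingEnd ℂ) (F p.2 θ) = (b p.1 * (starRingEnd ℂ) (b p.2)) *
        (exp (e p.1 * θ * I) * (starRingEnd ℂ) (exp (e p.2 * θ * I))) := by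
      intro θ
      simp only [hF, map_mul]
      ring
    simp only [h1]
    rw [intervalIntegral.integral_const_mul, integral_exp_sub_mul_I]
    by_cases h : p.1 = p.2
    · rw [if_pos h, if_pos (congrArg e h), ← h, mul_conj, normSq_eq_norm_sq]
      push_cast
      ring
    · rw [if_neg h, if_neg (fun h' => h (he h')), mul_zero]
  simp only [hterm] at hint
  -- By orthogonality the double series lives on the diagonal.
  have hdiag : Function.Injective fun n : ℕ => (n, n) := fun m n h => (Prod.ext_iff.1 h).1
  rw [← hdiag.hasSum_iff] at hint
  · have h2 := hint.tsum_eq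
    simp only [Function.comp_def, if_true] at h2
    rw [← ofReal_tsum, intervalIntegral.integral_ofReal, ofReal_inj, tsum_mul_left] at h2
    exact h2.symm
  · rintro ⟨m, n⟩ h
    exact if_neg fun hmn => h ⟨m, Prod.ext rfl hmn⟩

/-! ### Absence of long runs in `A` -/

/-- Constant representation counts prevent long runs of consecutive elements. -/
theorem exists_notMem_of_relRep_const {r : ℕ → ℕ → Prop} (hr : ∀ a b, a < b → r a b) {k : ℕ}
    (hk : 2 ≤ k) {A : Set ℕ} {c N : ℕ} (hc : ∀ n, N ≤ n → relRep r k A n = c) (n : ℕ)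
    (hn : N ≤ n) : ∃ j < 2 * c + 3 + k, n + j ∉ A := by
  by_contra! hall
  obtain ⟨l, rfl⟩ : ∃ l, k = l + 2 := ⟨k - 2, by omega⟩
  -- The first two entries move towards each other, so the sum s does not depend on i. The values i
  -- = 0, …, c give c + 1 strictly increasing tuples, one more than the c allowed.
  set t : ℕ → Fin (l + 2) → ℕ := fun i => Fin.cons (n + i)
    (Fin.cons (n + (2 * c + 2 - i)) fun m : Fin l => n + (2 * c + 3 + m)) with ht
  set s : ℕ := n + (n + (2 * c + 2)) + ∑ m : Fin l, (n + (2 * c + 3 + m)) with hs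
  have hsub : t '' (Finset.range (c + 1) : Set ℕ) ⊆ {a : Fin (l + 2) → ℕ | (∀ i, a i ∈ A) ∧
      (∀ i j, i < j → r (a i) (a j)) ∧ ∑ i, a i = s} := by
    rintro _ ⟨i, hi, rfl⟩
    have hi' : i ≤ c := by simpa [Nat.lt_succ_iff] using hi
    refine ⟨fun m => ?_, fun a b hab => hr _ _ ?_, ?_⟩
    · refine Fin.cases ?_ (fun m => Fin.cases ?_ (fun m => ?_) m) m
      · exact hall _ (by omega)
      · exact hall _ (by omega)
      · exact hall _ (by omega)
    · have hmono : StrictMono (t i) := by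
        rw [Fin.strictMono_iff_lt_succ]
        intro m
        refine Fin.cases ?_ (fun m => ?_) m
        · simp [ht]
          omega
        · rcases l with _ | l
          · exact m.elim0
          · refine Fin.cases ?_ (fun m => ?_) m
            · change n + (2 * c + 2 - i) < n + (2 * c + 3 + 0)
              omega
            · simp [ht]
      exact hmono hab
    · rw [Fin.sum_univ_succ, Fin.sum_univ_succ]
      simp only [ht, hs, Fin.cons_zero, Fin.cons_succ]
      omega
  have hinj : Function.Injective t := fun i j hij => by
    have := congrFun hij 0
    simpa [ht] using this
  have h1 := Set.ncard_le_ncard hsub (finite_relRep r (l + 2) A s)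
  rw [Set.ncard_image_of_injective _ hinj, Set.ncard_coe_finset, Finset.card_range] at h1
  have h2 : relRep r (l + 2) A s = c := hc s (by omega)
  rw [relRep] at h2
  omega

/-! ### Multiplication by 1 - z -/

/-- The coefficients of `(1 - z) * ∑ b n * z ^ n`. -/
def backwardDiff (b : ℕ → ℂ) (n : ℕ) : ℂ := b n - if n = 0 then 0 else b (n - 1)

theorem backwardDiff_succ (b : ℕ → ℂ) (n : ℕ) : backwardDiff b (n + 1) = b (n + 1) - b n := by
  simp [backwardDiff]

theorem norm_backwardDiff_le {b : ℕ → ℂ} {B : ℝ} (hb : ∀ n, ‖b n‖ ≤ B) (n : ℕ) :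
    ‖backwardDiff b n‖ ≤ 2 * B := by
  have hB : 0 ≤ B := (norm_nonneg _).trans (hb 0)
  rcases n with _ | n
  · simpa [backwardDiff] using (hb 0).trans (by linarith)
  · rw [backwardDiff_succ]
    linarith [norm_sub_le (b (n + 1)) (b n), hb n, hb (n + 1)]

theorem one_sub_mul_tsum {b : ℕ → ℂ} {B : ℝ} (hb : ∀ n, ‖b n‖ ≤ B) {z : ℂ} (hz : ‖z‖ < 1) :
    (1 - z) * ∑' n, b n * z ^ n = ∑' n, backwardDiff b n * z ^ n := by
  have h1 := (summable_norm_mul_pow hb hz).of_norm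
  have h2 := (summable_norm_mul_pow (norm_backwardDiff_le hb) hz).of_norm
  rw [h2.tsum_eq_zero_add]
  simp only [backwardDiff_succ]
  have h3 : Summable fun n => b (n + 1) * z ^ (n + 1) := (summable_nat_add_iff 1).2 h1
  have h4 : ∀ n, (b (n + 1) - b n) * z ^ (n + 1) = b (n + 1) * z ^ (n + 1) - z * (b n * z ^ n) :=
    fun n => by ring
  simp only [h4]
  rw [h3.tsum_sub (h1.mul_left z), tsum_mul_left, sub_mul, one_mul]
  nth_rewrite 1 [h1.tsum_eq_zero_add]
  simp [backwardDiff]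
  ring

/-- The backward differences vanish beyond index N, leaving N + 1 coefficients of size at most 2B.
-/
theorem norm_one_sub_mul_tsum_le {b : ℕ → ℂ} {B : ℝ} (hb : ∀ n, ‖b n‖ ≤ B) {N : ℕ} {c : ℂ}
    (hc : ∀ n, N ≤ n → b n = c) {z : ℂ} (hz : ‖z‖ < 1) :
    ‖(1 - z) * ∑' n, b n * z ^ n‖ ≤ (N + 1) * (2 * B) := by
  rw [one_sub_mul_tsum hb hz, tsum_eq_sum (s := Finset.range (N + 1))]
  · refine (norm_sum_le _ _).trans ((Finset.sum_le_card_nsmul _ _ (2 * B) fun n _ => ?_).trans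
      (le_of_eq (by simp)))
    rw [norm_mul, norm_pow]
    calc ‖backwardDiff b n‖ * ‖z‖ ^ n ≤ ‖backwardDiff b n‖ * 1 := by
          gcongr
          exact pow_le_one₀ (norm_nonneg z) hz.le
      _ ≤ 2 * B := by simpa using norm_backwardDiff_le hb n
  · intro n hn
    obtain ⟨m, rfl⟩ : ∃ m, n = m + 1 := ⟨n - 1, by simp at hn; omega⟩
    rw [backwardDiff_succ, hc (m + 1) (by simp at hn; omega), hc m (by simp at hn; omega)]
    simp

/-! ### Power series on circles -/

theorem norm_circleMap_lt_one {x : ℝ} (hx0 : 0 ≤ x) (hx1 : x < 1) (θ : ℝ) :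
    ‖circleMap 0 x θ‖ < 1 := by
  simpa [abs_of_nonneg hx0] using hx1

theorem summable_norm_sq_mul_pow {b : ℕ → ℂ} {B : ℝ} (hb : ∀ n, ‖b n‖ ≤ B) {x : ℝ} (hx0 : 0 ≤ x)
    (hx1 : x < 1) : Summable fun n => ‖b n‖ ^ 2 * x ^ (2 * n) := by
  have hx2 : x ^ 2 < 1 := pow_lt_one₀ hx0 hx1 (by norm_num)
  refine Summable.of_nonneg_of_le (fun _ => by positivity) (fun n => ?_)
    ((summable_geometric_of_lt_one (by positivity) hx2).mul_left (B ^ 2))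
  rw [← pow_mul]
  gcongr
  exact hb n

theorem integral_norm_sq_powerSeries {b : ℕ → ℂ} {B : ℝ} (hb : ∀ n, ‖b n‖ ≤ B) {x : ℝ}
    (hx0 : 0 ≤ x) (hx1 : x < 1) {j : ℕ} (hj : 1 ≤ j) :
    ∫ θ in (0 : ℝ)..2 * Real.pi, ‖∑' n, b n * (circleMap 0 x θ ^ j) ^ n‖ ^ 2 =
      2 * Real.pi * ∑' n, ‖b n‖ ^ 2 * (x ^ j) ^ (2 * n) := by
  have hxj : ‖((x ^ j : ℝ) : ℂ)‖ < 1 := by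
    rw [Complex.norm_real, Real.norm_of_nonneg (by positivity)]
    exact pow_lt_one₀ hx0 hx1 (by omega)
  have h := integral_norm_sq_tsum (summable_norm_mul_pow hb hxj) (e := fun n => j * n)
    (fun m n hmn => Nat.eq_of_mul_eq_mul_left hj hmn)
  have h1 : ∀ (n : ℕ) (θ : ℝ), b n * (circleMap 0 x θ ^ j) ^ n =
      b n * ((x ^ j : ℝ) : ℂ) ^ n * Complex.exp ((j * n : ℕ) * θ * Complex.I) := by
    intro n θ
    rw [circleMap_zero, mul_pow, mul_pow, mul_assoc, ← pow_mul (Complex.exp _), ← Complex.exp_nat_mul,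
      mul_assoc ((j * n : ℕ) : ℂ)]
    push_cast
    rfl
  have h2 : ∀ n, ‖b n‖ ^ 2 * (x ^ j) ^ (2 * n) = ‖b n * ((x ^ j : ℝ) : ℂ) ^ n‖ ^ 2 := by
    intro n
    rw [norm_mul, norm_pow, Complex.norm_real, Real.norm_of_nonneg (by positivity)]
    ring
  simp only [h1, h2]
  exact h

theorem continuous_powerSeries_circleMap {b : ℕ → ℂ} {B : ℝ} (hb : ∀ n, ‖b n‖ ≤ B) {x : ℝ}
    (hx0 : 0 ≤ x) (hx1 : x < 1) {j : ℕ} (hj : 1 ≤ j) :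
    Continuous fun θ => ∑' n, b n * (circleMap 0 x θ ^ j) ^ n := by
  have hxj : ‖((x ^ j : ℝ) : ℂ)‖ < 1 := by
    rw [Complex.norm_real, Real.norm_of_nonneg (by positivity)]
    exact pow_lt_one₀ hx0 hx1 (by omega)
  refine continuous_tsum (fun n => ?_) (summable_norm_mul_pow hb hxj) fun n θ => ?_
  · exact continuous_const.mul (((continuous_circleMap 0 x).pow j).pow n)
  · simp [abs_of_nonneg hx0]

/-! ### Jumps of the indicator against its weighted mass -/

/-- Walking up from n, the first point outside A is a jump of the indicator, of size 1. -/
theorem one_le_sum_norm_sq_backwardDiff {A : Set ℕ} {n D : ℕ} (hn : n ∈ A)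
    (hD : ∃ j < D, n + j ∉ A) :
    1 ≤ ∑ j ∈ Finset.range D,
      ‖backwardDiff (A.indicator fun _ => (1 : ℂ)) (n + j + 1)‖ ^ 2 := by
  classical
  obtain ⟨j, hj, hjA⟩ := hD
  have hex : ∃ j, n + j ∉ A := ⟨j, hjA⟩
  have h0 : Nat.find hex ≠ 0 := fun h => by
    have := Nat.find_spec hex
    rw [h] at this
    exact this hn
  obtain ⟨i, hi⟩ := Nat.exists_eq_succ_of_ne_zero h0
  have h1 : n + i ∈ A := by
    have := Nat.find_min hex (m := i) (by omega)
    simpa using this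
  have h2 : n + i + 1 ∉ A := by
    have := Nat.find_spec hex
    rwa [hi] at this
  have h3 : i < D := by
    have := Nat.find_min' hex hjA
    omega
  have h4 : ‖backwardDiff (A.indicator fun _ => (1 : ℂ)) (n + i + 1)‖ ^ 2 = 1 := by
    rw [backwardDiff_succ]
    simp [h1, h2]
  rw [← h4]
  exact Finset.single_le_sum
    (f := fun j => ‖backwardDiff (A.indicator fun _ => (1 : ℂ)) (n + j + 1)‖ ^ 2)
    (fun _ _ => by positivity) (Finset.mem_range.2 h3)

/-- Each element of A from N on is charged to the jumps within distance D above it. A jump is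
charged at most D times, and since x ≥ 1/2 the weights across that distance differ by a factor at
most 4 ^ D. The elements below N contribute at most N. -/
theorem tsum_indicator_le_tsum_backwardDiff {A : Set ℕ} {N D : ℕ}
    (hD : ∀ n, N ≤ n → ∃ j < D, n + j ∉ A) {x : ℝ} (hx0 : 1 / 2 ≤ x) (hx1 : x < 1) :
    ∑' n, ‖A.indicator (fun _ => (1 : ℂ)) n‖ ^ 2 * x ^ (2 * n) ≤ N + D * 4 ^ D *
      ∑' n, ‖backwardDiff (A.indicator fun _ => (1 : ℂ)) n‖ ^ 2 * x ^ (2 * n) := by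
  have hx : 0 ≤ x := by linarith
  set d : ℕ → ℝ := fun n => ‖backwardDiff (A.indicator fun _ => (1 : ℂ)) n‖ ^ 2 * x ^ (2 * n)
    with hd
  have hd0 : ∀ n, 0 ≤ d n := fun n => by positivity
  have hds : Summable d :=
    summable_norm_sq_mul_pow (norm_backwardDiff_le (norm_indicator_one_le A)) hx hx1
  have hshift : ∀ j, Summable fun n => d (n + j + 1) := fun j =>
    (summable_nat_add_iff (j + 1)).2 hds
  have hI : Summable fun n => if n < N then (1 : ℝ) else 0 := by
    refine summable_of_hasFiniteSupport ((Set.finite_Iio N).subset fun n hn => ?_)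
    by_contra h
    simp_all
  have hS : Summable fun n => (4 : ℝ) ^ D * ∑ j ∈ Finset.range D, d (n + j + 1) :=
    (summable_sum fun j _ => hshift j).mul_left _
  have hle : ∀ n, ‖A.indicator (fun _ => (1 : ℂ)) n‖ ^ 2 * x ^ (2 * n) ≤
      (if n < N then (1 : ℝ) else 0) + 4 ^ D * ∑ j ∈ Finset.range D, d (n + j + 1) := by
    intro n
    have hsum0 : 0 ≤ (4 : ℝ) ^ D * ∑ j ∈ Finset.range D, d (n + j + 1) :=
      mul_nonneg (by positivity) (Finset.sum_nonneg fun j _ => hd0 _)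
    by_cases hnA : n ∈ A
    · rw [Set.indicator_of_mem hnA, norm_one, one_pow, one_mul]
      split_ifs with hnN
      · linarith [pow_le_one₀ (n := 2 * n) hx hx1.le]
      · rw [zero_add]
        calc x ^ (2 * n) = 1 * x ^ (2 * n) := (one_mul _).symm
          _ ≤ (∑ j ∈ Finset.range D,
              ‖backwardDiff (A.indicator fun _ => (1 : ℂ)) (n + j + 1)‖ ^ 2) * x ^ (2 * n) := by
            gcongr
            exact one_le_sum_norm_sq_backwardDiff hnA (hD n (not_lt.1 hnN))
          _ ≤ _ := by
            rw [Finset.sum_mul, Finset.mul_sum]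
            refine Finset.sum_le_sum fun j hj => ?_
            have hj' : j + 1 ≤ D := Finset.mem_range.1 hj
            have h4 : 1 ≤ (4 : ℝ) ^ D * x ^ (2 * (j + 1)) := by
              calc (1 : ℝ) ≤ (4 * x ^ 2) ^ (j + 1) := one_le_pow₀ (by nlinarith)
                _ = 4 ^ (j + 1) * x ^ (2 * (j + 1)) := by rw [mul_pow, ← pow_mul]
                _ ≤ 4 ^ D * x ^ (2 * (j + 1)) := by
                  gcongr
                  norm_num
            calc _ ≤ ‖backwardDiff (A.indicator fun _ => (1 : ℂ)) (n + j + 1)‖ ^ 2 *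
                  x ^ (2 * n) * ((4 : ℝ) ^ D * x ^ (2 * (j + 1))) :=
                  le_mul_of_one_le_right (by positivity) h4
              _ = 4 ^ D * d (n + j + 1) := by
                simp only [hd]
                ring
    · rw [Set.indicator_of_notMem hnA]
      have : (0 : ℝ) ≤ if n < N then (1 : ℝ) else 0 := by split_ifs <;> norm_num
      simpa using add_nonneg this hsum0
  refine ((summable_norm_sq_mul_pow (norm_indicator_one_le A) hx hx1).tsum_le_tsum hle
    (hI.add hS)).trans ?_
  rw [hI.tsum_add hS, tsum_mul_left, Summable.tsum_finsetSum fun j _ => hshift j]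
  have h1 : ∑' n, (if n < N then (1 : ℝ) else 0) = N := by
    rw [tsum_eq_sum (s := Finset.range N)]
    · rw [Finset.sum_congr rfl (g := fun _ => (1 : ℝ)) fun n hn => if_pos (Finset.mem_range.1 hn)]
      simp
    · intro n hn
      exact if_neg fun h => hn (Finset.mem_range.2 h)
  have h2 : ∑ j ∈ Finset.range D, ∑' n, d (n + j + 1) ≤ D * ∑' n, d n := by
    refine (Finset.sum_le_card_nsmul _ _ (∑' n, d n) fun j _ => ?_).trans (le_of_eq (by simp))
    exact tsum_comp_le_tsum_of_inj hds hd0 (add_left_injective (j + 1))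
  rw [h1]
  have h3 := mul_le_mul_of_nonneg_left h2 (show (0 : ℝ) ≤ 4 ^ D by positivity)
  linarith

theorem exists_lt_tsum_indicator {A : Set ℕ} (hA : A.Infinite) (R : ℝ) :
    ∃ x : ℝ, 1 / 2 ≤ x ∧ x < 1 ∧
      R < ∑' n, ‖A.indicator (fun _ => (1 : ℂ)) n‖ ^ 2 * x ^ (2 * n) := by
  obtain ⟨m, hm⟩ := exists_nat_gt R
  obtain ⟨F, hFA, hF⟩ := hA.exists_subset_card_eq m
  have h1 : Tendsto (fun x : ℝ => ∑ n ∈ F, x ^ (2 * n)) (𝓝[<] 1) (𝓝 (m : ℝ)) := by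
    have hcont : Continuous fun x : ℝ => ∑ n ∈ F, x ^ (2 * n) := by fun_prop
    have := hcont.tendsto 1
    simp only [one_pow, Finset.sum_const, hF, nsmul_eq_mul, mul_one] at this
    exact this.mono_left nhdsWithin_le_nhds
  have h2 : ∀ᶠ x : ℝ in 𝓝[<] 1, x ∈ Set.Ico (1 / 2 : ℝ) 1 :=
    Ico_mem_nhdsLT (by norm_num)
  obtain ⟨x, hxR, hx0, hx1⟩ := ((h1.eventually_const_lt hm).and h2).exists
  refine ⟨x, hx0, hx1, hxR.trans_le ?_⟩
  have hx : 0 ≤ x := by linarith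
  refine le_trans (le_of_eq ?_)
    ((summable_norm_sq_mul_pow (norm_indicator_one_le A) hx hx1).sum_le_tsum F
      fun n _ => by positivity)
  exact Finset.sum_congr rfl fun n hn => by simp [hFA hn]

/-! ### The pointwise bound, its integral, and the contradiction -/

-- Take T = √W. As W ≥ 1 and W exceeds every |f(z^j)|, also T^j ≥ W > |f(z^j)| for j ≥ 2. If f(z) is
-- dominated by T, squaring gives a bound linear in W; otherwise |1 - z|^k |f(z)|^k is bounded
-- because (1 - z)H(z) is.
open Nat in
theorem NewtonRel.norm_sq_one_sub_mul_genFun_le {r : ℕ → ℕ → Prop} {ε : ℂ} (hr : NewtonRel r ε)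
    (hε : ‖ε‖ = 1) {k : ℕ} (hk : 2 ≤ k) {A : Set ℕ} {B N c : ℕ} (hB : ∀ n, relRep r k A n ≤ B)
    (hc : ∀ n, N ≤ n → relRep r k A n = c) {z : ℂ} (hz : ‖z‖ < 1) :
    ‖(1 - z) * genFun A z‖ ^ 2 ≤ (1 + 2 * (k ! : ℝ) * ((N + 1) * (2 * B)) * 2 ^ k) ^ 2 +
      4 * ((k ! : ℝ) * k * 2 ^ k) ^ 2 * (1 + ∑ j ∈ Finset.Icc 2 k, ‖genFun A (z ^ j)‖) := by
  set W : ℝ := 1 + ∑ j ∈ Finset.Icc 2 k, ‖genFun A (z ^ j)‖ with hW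
  set K : ℝ := (k ! : ℝ) * k * 2 ^ k with hK
  set Q : ℝ := 2 * (k ! : ℝ) * ((N + 1) * (2 * B)) * 2 ^ k with hQ
  have hQ0 : 0 ≤ Q := by positivity
  have hW1 : 1 ≤ W := by
    have : 0 ≤ ∑ j ∈ Finset.Icc 2 k, ‖genFun A (z ^ j)‖ :=
      Finset.sum_nonneg fun _ _ => norm_nonneg _
    linarith
  have hsqrt : 1 ≤ √W := Real.one_le_sqrt.2 hW1
  have hsq : √W ^ 2 = W := Real.sq_sqrt (by linarith)
  have hz2 : ‖1 - z‖ ≤ 2 := by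
    have := norm_sub_le (1 : ℂ) z
    rw [norm_one] at this
    linarith
  have hdich := hr.genFun_le_or_pow_le hε (by omega) hB hz (Real.sqrt_nonneg W) (fun j h2 hjk => by
    have h1 : ‖genFun A (z ^ j)‖ ≤ ∑ j ∈ Finset.Icc 2 k, ‖genFun A (z ^ j)‖ :=
      Finset.single_le_sum (f := fun j => ‖genFun A (z ^ j)‖) (fun _ _ => norm_nonneg _)
        (Finset.mem_Icc.2 ⟨h2, hjk⟩)
    have h3 : √W ^ 2 ≤ √W ^ j := pow_le_pow_right₀ hsqrt h2
    linarith)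
  rw [norm_mul]
  rcases hdich with h | h
  · have h1 : ‖1 - z‖ * ‖genFun A z‖ ≤ 2 * (K * √W) := by gcongr
    calc (‖1 - z‖ * ‖genFun A z‖) ^ 2 ≤ (2 * (K * √W)) ^ 2 := by gcongr
      _ = 4 * K ^ 2 * W := by rw [mul_pow, mul_pow, hsq]; ring
      _ ≤ _ := by linarith [sq_nonneg (1 + Q)]
  · set u : ℝ := ‖1 - z‖ * ‖genFun A z‖ with hu
    have hu0 : 0 ≤ u := by positivity
    have hG := norm_one_sub_mul_tsum_le (b := fun n => (relRep r k A n : ℂ)) (B := B) (N := N)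
      (fun n => by rw [Complex.norm_natCast]; exact_mod_cast hB n) (c := (c : ℂ))
      (fun n hn => by simp only [hc n hn]) hz
    rw [norm_mul] at hG
    set g : ℝ := ‖∑' n : ℕ, (relRep r k A n : ℂ) * z ^ n‖ with hg
    have huk : u ^ k ≤ Q := by
      obtain ⟨m, rfl⟩ : ∃ m, k = m + 1 := ⟨k - 1, by omega⟩
      calc u ^ (m + 1) = ‖1 - z‖ ^ m * ‖1 - z‖ * ‖genFun A z‖ ^ (m + 1) := by
            rw [hu, mul_pow, pow_succ ‖1 - z‖]
        _ ≤ ‖1 - z‖ ^ m * ‖1 - z‖ * (2 * ((m + 1)! : ℝ) * g) := by gcongr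
        _ = ‖1 - z‖ ^ m * (2 * ((m + 1)! : ℝ)) * (‖1 - z‖ * g) := by ring
        _ ≤ 2 ^ m * (2 * ((m + 1)! : ℝ)) * ((N + 1) * (2 * B)) := by gcongr
        _ ≤ 2 ^ (m + 1) * (2 * ((m + 1)! : ℝ)) * ((N + 1) * (2 * B)) := by
            gcongr <;> norm_num
        _ = Q := by rw [hQ]; ring
    have hu1 : u ≤ 1 + Q := by
      rcases le_total u 1 with h1 | h1
      · linarith
      · linarith [le_self_pow₀ h1 (show k ≠ 0 by omega)]
    have h2 : u ^ 2 ≤ (1 + Q) ^ 2 := by gcongr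
    have h3 : 0 ≤ 4 * K ^ 2 * W := by positivity
    linarith

open Real in
/-- Integrating a pointwise bound over the circle of radius `x`. -/
theorem tsum_backwardDiff_le {A : Set ℕ} {k : ℕ} {C E : ℝ} (hE : 0 ≤ E)
    (h : ∀ z : ℂ, ‖z‖ < 1 → ‖(1 - z) * genFun A z‖ ^ 2 ≤
      C + E * (1 + ∑ j ∈ Finset.Icc 2 k, ‖genFun A (z ^ j)‖))
    {η : ℝ} (hη : 0 < η) {x : ℝ} (hx0 : 0 ≤ x) (hx1 : x < 1) :
    ∑' n, ‖backwardDiff (A.indicator fun _ => (1 : ℂ)) n‖ ^ 2 * x ^ (2 * n) ≤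
      C + E * (1 + k * (η * (∑' n, ‖A.indicator (fun _ => (1 : ℂ)) n‖ ^ 2 * x ^ (2 * n)) +
        1 / η)) := by
  set M : ℝ := ∑' n, ‖A.indicator (fun _ => (1 : ℂ)) n‖ ^ 2 * x ^ (2 * n) with hM
  have hind := norm_indicator_one_le A
  have hM0 : 0 ≤ M := tsum_nonneg fun n => by positivity
  have hcont : ∀ j, 1 ≤ j → Continuous fun θ => genFun A (circleMap 0 x θ ^ j) := fun j hj =>
    continuous_powerSeries_circleMap hind hx0 hx1 hj
  have hcont1 : Continuous fun θ => genFun A (circleMap 0 x θ) := by simpa using hcont 1 le_rfl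
  have hpj : ∀ j ∈ Finset.Icc 2 k,
      ∫ θ in (0 : ℝ)..2 * π, ‖genFun A (circleMap 0 x θ ^ j)‖ ^ 2 ≤ 2 * π * M := by
    intro j hj
    have hj1 : 1 ≤ j := by linarith [(Finset.mem_Icc.1 hj).1]
    refine (integral_norm_sq_powerSeries hind hx0 hx1 hj1).le.trans ?_
    -- Replacing z by z^j shrinks the radius to x^j, which only decreases the Parseval sum.
    have hxj : x ^ j ≤ x := pow_le_of_le_one hx0 hx1.le (by omega)
    gcongr ?_ * ?_
    refine (summable_norm_sq_mul_pow hind (by positivity) (hxj.trans_lt hx1)).tsum_le_tsum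
      (fun n => ?_) (summable_norm_sq_mul_pow hind hx0 hx1)
    gcongr
  have hcontj : ∀ j ∈ Finset.Icc 2 k,
      Continuous fun θ => η * ‖genFun A (circleMap 0 x θ ^ j)‖ ^ 2 + 1 / η := by
    intro j hj
    have := hcont j (by linarith [(Finset.mem_Icc.1 hj).1])
    fun_prop
  have hcontS : Continuous fun θ => ∑ j ∈ Finset.Icc 2 k,
      (η * ‖genFun A (circleMap 0 x θ ^ j)‖ ^ 2 + 1 / η) := continuous_finsetSum _ hcontj
  have hint : ∫ θ in (0 : ℝ)..2 * π, ‖(1 - circleMap 0 x θ) * genFun A (circleMap 0 x θ)‖ ^ 2 ≤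
      ∫ θ in (0 : ℝ)..2 * π, (C + E * (1 + ∑ j ∈ Finset.Icc 2 k,
        (η * ‖genFun A (circleMap 0 x θ ^ j)‖ ^ 2 + 1 / η))) := by
    refine intervalIntegral.integral_mono_on (by positivity) ?_ ?_ fun θ _ => ?_
    · have := continuous_circleMap 0 x
      exact Continuous.intervalIntegrable (by fun_prop) _ _
    · exact Continuous.intervalIntegrable (by fun_prop) _ _
    · refine (h _ (norm_circleMap_lt_one hx0 hx1 θ)).trans ?_
      gcongr with j _
      set t := ‖genFun A (circleMap 0 x θ ^ j)‖
      -- Completing the square gives t ≤ η t² + 1/η, trading the first power for a small multiple of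
      -- the mean square.
      have h1 : η * t ^ 2 + 1 / η - t = (η * t - 1 / 2) ^ 2 / η + 3 / (4 * η) := by
        field_simp
        ring
      have h2 : 0 ≤ (η * t - 1 / 2) ^ 2 / η + 3 / (4 * η) := by positivity
      linarith
  have hL : ∫ θ in (0 : ℝ)..2 * π, ‖(1 - circleMap 0 x θ) * genFun A (circleMap 0 x θ)‖ ^ 2 =
      2 * π * ∑' n, ‖backwardDiff (A.indicator fun _ => (1 : ℂ)) n‖ ^ 2 * x ^ (2 * n) := by
    have h1 := integral_norm_sq_powerSeries (norm_backwardDiff_le hind) hx0 hx1 le_rfl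
    simp only [pow_one] at h1
    rw [← h1]
    refine intervalIntegral.integral_congr fun θ _ => ?_
    simp only [genFun]
    rw [one_sub_mul_tsum hind (norm_circleMap_lt_one hx0 hx1 θ)]
  have hR : ∫ θ in (0 : ℝ)..2 * π, (C + E * (1 + ∑ j ∈ Finset.Icc 2 k,
      (η * ‖genFun A (circleMap 0 x θ ^ j)‖ ^ 2 + 1 / η))) ≤
      2 * π * (C + E * (1 + k * (η * M + 1 / η))) := by
    rw [intervalIntegral.integral_add intervalIntegrable_const
      (Continuous.intervalIntegrable (by fun_prop) _ _), intervalIntegral.integral_const_mul,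
      intervalIntegral.integral_add intervalIntegrable_const
      (hcontS.intervalIntegrable _ _),
      intervalIntegral.integral_finsetSum fun j hj => (hcontj j hj).intervalIntegrable _ _]
    have hterm : ∀ j ∈ Finset.Icc 2 k, ∫ θ in (0 : ℝ)..2 * π,
        (η * ‖genFun A (circleMap 0 x θ ^ j)‖ ^ 2 + 1 / η) ≤ 2 * π * (η * M + 1 / η) := by
      intro j hj
      have := hcont j (by linarith [(Finset.mem_Icc.1 hj).1])
      rw [intervalIntegral.integral_add (Continuous.intervalIntegrable (by fun_prop) _ _)
        intervalIntegrable_const, intervalIntegral.integral_const_mul,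
        intervalIntegral.integral_const, sub_zero, smul_eq_mul]
      linarith [mul_le_mul_of_nonneg_left (hpj j hj) hη.le]
    have hsum := Finset.sum_le_card_nsmul _ _ _ hterm
    have hcard : ((Finset.Icc 2 k).card : ℝ) ≤ k := by
      rw [Nat.card_Icc]
      exact_mod_cast (by omega : k + 1 - 2 ≤ k)
    rw [nsmul_eq_mul] at hsum
    have hpos : 0 ≤ 2 * π * (η * M + 1 / η) := by positivity
    have hsum2 := hsum.trans (mul_le_mul_of_nonneg_right hcard hpos)
    simp only [intervalIntegral.integral_const, sub_zero, smul_eq_mul]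
    linarith [mul_le_mul_of_nonneg_left hsum2 hE]
  rw [hL] at hint
  exact le_of_mul_le_mul_left (hint.trans hR) (by positivity)

open Nat in
theorem NewtonRel.not_eventually_const {r : ℕ → ℕ → Prop} {ε : ℂ} (hr : NewtonRel r ε)
    (hε : ‖ε‖ = 1) (hlt : ∀ a b, a < b → r a b) {k : ℕ} (hk : 2 ≤ k) {A : Set ℕ}
    (hA : A.Infinite) {c N : ℕ} (hc : ∀ n, N ≤ n → relRep r k A n = c) : False := by
  set B : ℕ := c + ∑ n ∈ Finset.range N, relRep r k A n with hBdef
  have hB : ∀ n, relRep r k A n ≤ B := by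
    intro n
    rcases lt_or_ge n N with h | h
    · exact (Finset.single_le_sum (f := fun n => relRep r k A n) (fun _ _ => Nat.zero_le _)
        (Finset.mem_range.2 h)).trans (Nat.le_add_left _ _)
    · rw [hc n h]
      exact Nat.le_add_right _ _
  set C : ℝ := (1 + 2 * (k ! : ℝ) * ((N + 1) * (2 * B)) * 2 ^ k) ^ 2 with hC
  set E : ℝ := 4 * ((k ! : ℝ) * k * 2 ^ k) ^ 2 with hE
  set D : ℕ := 2 * c + 3 + k with hD
  set P : ℝ := D * 4 ^ D with hP
  have hk0 : (0 : ℝ) < k := by exact_mod_cast (by omega : 0 < k)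
  have hE0 : 0 < E := by
    have : (0 : ℝ) < k ! := by exact_mod_cast Nat.factorial_pos k
    positivity
  have hP0 : 0 < P := by
    have : (0 : ℝ) < D := by exact_mod_cast (by omega : 0 < D)
    positivity
  -- Chosen so that the coefficient P·E·k·η of M on the right is 1/2, to be absorbed on the left.
  set η : ℝ := 1 / (2 * P * E * k) with hη
  have hη0 : 0 < η := by positivity
  -- The threshold is twice the part of the upper bound free of M, contradicting M ≤ (that part) +
  -- M/2.
  obtain ⟨x, hx0, hx1, hx⟩ := exists_lt_tsum_indicator hA
    (2 * (N + P * (C + E * (1 + k * (1 / η)))))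
  have h1 := tsum_backwardDiff_le hE0.le
    (fun z hz => hr.norm_sq_one_sub_mul_genFun_le hε hk hB hc hz) hη0 (by linarith) hx1
  have h2 := tsum_indicator_le_tsum_backwardDiff (exists_notMem_of_relRep_const hlt hk hc) hx0 hx1
  set M : ℝ := ∑' n, ‖A.indicator (fun _ => (1 : ℂ)) n‖ ^ 2 * x ^ (2 * n)
  have h3 := h2.trans (add_le_add_right (mul_le_mul_of_nonneg_left h1 hP0.le) (N : ℝ))
  have h4 : P * E * k * η = 1 / 2 := by
    rw [hη]
    field_simp
  have h5 : (N : ℝ) + P * (C + E * (1 + k * (η * M + 1 / η))) =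
      N + P * (C + E * (1 + k * (1 / η))) + (P * E * k * η) * M := by ring
  rw [h5, h4] at h3
  linarith

theorem orderedRepLE_eq_relRep (k : ℕ) (A : Set ℕ) (n : ℕ) :
    orderedRepLE k A n = relRep (· ≤ ·) k A n := by
  simp only [orderedRepLE, relRep, monotone_iff_forall_lt]

theorem orderedRepLT_eq_relRep (k : ℕ) (A : Set ℕ) (n : ℕ) :
    orderedRepLT k A n = relRep (· < ·) k A n := rfl

theorem corollary3 (k : ℕ) (hk : 2 ≤ k) :
    (¬ ∃ A : Set ℕ, A.Infinite ∧ ∃ c N : ℕ, ∀ n : ℕ, N ≤ n → orderedRepLE k A n = c) ∧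
    (¬ ∃ A : Set ℕ, A.Infinite ∧ ∃ c N : ℕ, ∀ n : ℕ, N ≤ n → orderedRepLT k A n = c) := by
  constructor
  · rintro ⟨A, hA, c, N, hc⟩
    exact newtonRel_le.not_eventually_const (by simp) (fun _ _ h => h.le) hk hA
      fun n hn => (orderedRepLE_eq_relRep k A n).symm.trans (hc n hn)
  · rintro ⟨A, hA, c, N, hc⟩
    exact newtonRel_lt.not_eventually_const (by simp) (fun _ _ h => h) hk hA
      fun n hn => (orderedRepLT_eq_relRep k A n).symm.trans (hc n hn)
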